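/- Let $\mathcal H$ be a separable complex Hilbert space, $\mathcal D\subset\mathcal H$ a dense linear subspace, and $\mathcal M$ an $O^*$-algebra on $\mathcal D$ containing the identity, i.e. a unital algebra of linear maps $\hat A:\mathcal D\to\mathcal D$ such that for every $\hat A\in\mathcal M$ the domain of the adjoint $\hat A^*$ contains $\mathcal D$ and $\hat A^*|_{\mathcal D}$ again belongs to $\mathcal M$. Let $X=\mathcal E_S(\mathcal M)$ be the set of positive trace class operators $\hat\rho$ on $\mathcal H$ with $\mathrm{Tr}\,\hat\rho=1$, $\hat\rho\mathcal H\subset\mathcal D$ and $\hat A\hat\rho$ trace class for all $\hat A\in\mathcal M$, with the weakest topology making all functions $\hat\rho\mapsto\mathrm{Tr}\,\hat A\hat\rho$ ($\hat A\in\mathcal M$) continuous. For essentially self-adjoint $\hat A\in\mathcal M$ put $a_Q(\hat\rho)=\mathrm{Tr}\,\hat A\hat\rho$, a continuous real function on $X$. For $U\subset X$ open let $\mathbb A(U)$ be the set of locally linear functions on $U$: those $f:U\to\mathbb R$ for which every point of $U$ has an open neighbourhood in $U$ on which $f$ coincides with $a_Q$ for some essentially self-adjoint $\hat A\in\mathcal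 M$. For a continuous $f:X\to\mathbb R$ and $V\subset X$ open let $f_-(V)$ and $f^+(V)$ be the sets of locally constant functions $q:V\to\mathbb Q$ with $q<f$, respectively $q>f$, at every point of $V$ (the lower and upper Dedekind cuts of $f$). Write $f\ge 0$ if $f^+(V)\subset 0^+(V)$ and $0_-(V)\subset f_-(V)$ for all open $V\subset X$, and $f>0$ if there is a locally constant $q:X\to\mathbb Q$ with $q\in 0^+(X)$ and $q\in f_-(X)$. For essentially self-adjoint $\hat A\in\mathcal M$ write $\hat A\ge 0$ if $\langle u,\hat Au\rangle\ge 0$ for all $u\in\mathcal D$, and $\hat A>0$ if there is a rational number $q>0$ with $\langle u,\hat Au\rangle>q$ for all unit vectors $u\in\mathcal D$. Then for every essentially self-adjoint $\hat A\in\mathcal M$, $$a_Q\ge 0\iff\hat A\ge 0,\qquad a_Q>0\iff\hat A>0 .$$ Consequently the two orders agree on the global sections of $\mathbb A$: for every $f\in\mathbb A(X)$ one has $f\ge 0$ (respectively $f>0$) if and only if $f=a_Q$ for some essentially self-adjoint $\hat A\in\mathcal M$ with $\hat A\ge 0$ (respectively $\hat A>0$). -/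

import Mathlib

noncomputable section

namespace QRNumber

open TopologicalSpace

/-! ### Trace class operators -/

section TraceClass

variable (H : Type*) [NormedAddCommGroup H] [InnerProductSpace ℂ H] [CompleteSpace H]

/-- The index set of a fixed orthonormal basis of the Hilbert space `H`. -/
def basisSet : Set H := (exists_hilbertBasis ℂ H).choose

/-- A fixed orthonormal basis of the Hilbert space `H`. -/
def onb : HilbertBasis (basisSet H) ℂ H := (exists_hilbertBasis ℂ H).choose_spec.choose

variable {H}

/-- A bounded operator `T` is trace class iff `Tr |T| < ∞`, where `|T| = √(T* T)` and
`Tr |T| = ∑ ⟨e i, |T| e i⟩` for an orthonormal basis `e`. -/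
def IsTraceClass (T : H →L[ℂ] H) : Prop :=
  Summable fun i => (inner ℂ (onb H i) (CFC.abs T (onb H i))).re

/-- An everywhere defined linear operator is trace class iff it is a bounded operator that is
trace class. -/
def IsTraceClassMap (L : H →ₗ[ℂ] H) : Prop :=
  ∃ S : H →L[ℂ] H, (S : H →ₗ[ℂ] H) = L ∧ IsTraceClass S

/-- The trace `Tr L = ∑ ⟨e i, L e i⟩`; it is only applied to trace class operators. -/
def trace (L : H →ₗ[ℂ] H) : ℂ := ∑' i, inner ℂ (onb H i) (L (onb H i))

end TraceClass

/-! ### Operators on a common invariant dense domain and O*-algebras -/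

variable {H : Type*} [NormedAddCommGroup H] [InnerProductSpace ℂ H] [CompleteSpace H]

/-- A linear map `D → D`, seen as an (unbounded) operator on `H` with domain `D`. -/
def toPMap {D : Submodule ℂ H} (A : Module.End ℂ D) : H →ₗ.[ℂ] H :=
  ⟨D, D.subtype ∘ₗ A⟩

/-- A unital O*-algebra on `D`: an algebra of linear maps `D → D` that contains the identity and
such that for each member `A` the domain of the Hilbert space adjoint `A*` contains `D`,
`A*` maps `D` into `D`, and the restriction of `A*` to `D` is a member again. -/
structure OStarAlgebra (D : Submodule ℂ H) where
  /-- The underlying algebra of linear maps of `D` into itself. -/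
  alg : Subalgebra ℂ (Module.End ℂ D)
  /-- Closure under the involution: `B` below is the restriction of `A*` to `D`. -/
  dagger_mem : ∀ A ∈ alg, ∃ B ∈ alg, toPMap B ≤ (toPMap A).adjoint

/-- Essential self-adjointness of an operator with dense domain `D`: the operator is symmetric
and its closure is self-adjoint. -/
def IsEssSelfAdjoint {D : Submodule ℂ H} (A : Module.End ℂ D) : Prop :=
  Dense (D : Set H) ∧ toPMap A ≤ (toPMap A).adjoint ∧ IsSelfAdjoint (toPMap A).closure

/-- The operator order `A ≥ 0`: `⟨u, A u⟩ ≥ 0` for all `u ∈ D`. -/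
def OpNonneg {D : Submodule ℂ H} (A : Module.End ℂ D) : Prop :=
  ∀ u : D, 0 ≤ (inner ℂ (u : H) (A u : H)).re

/-- The operator order `A > 0`: `A` is bounded below by a positive rational number `q`, that is
`⟨u, A u⟩ > q` for all unit vectors `u ∈ D`. -/
def OpPos {D : Submodule ℂ H} (A : Module.End ℂ D) : Prop :=
  ∃ q : ℚ, 0 < q ∧ ∀ u : D, ‖(u : H)‖ = 1 → (q : ℝ) < (inner ℂ (u : H) (A u : H)).re

/-- The product `A T`, for `A : D → D` and a bounded operator `T` with range in `D`, as an
everywhere defined operator on `H`. -/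
def mulOp {D : Submodule ℂ H} (A : Module.End ℂ D) (T : H →L[ℂ] H) (hT : ∀ x, T x ∈ D) :
    H →ₗ[ℂ] H :=
  D.subtype ∘ₗ A ∘ₗ (T : H →ₗ[ℂ] H).codRestrict D hT

/-! ### The state space -/

/-- The set of trace class operators `T` with `T H ⊆ D`, `T* H ⊆ D` and with `A T` and `A T*`
trace class for all `A` in the O*-algebra. -/
structure MemT1 {D : Submodule ℂ H} (M : OStarAlgebra D) (T : H →L[ℂ] H) : Prop where
  traceClass : IsTraceClass T
  range_mem : ∀ x, T x ∈ D
  adjoint_range_mem : ∀ x, T.adjoint x ∈ D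
  mul_traceClass : ∀ A ∈ M.alg, IsTraceClassMap (mulOp A T range_mem)
  mul_adjoint_traceClass : ∀ A ∈ M.alg, IsTraceClassMap (mulOp A T.adjoint adjoint_range_mem)

/-- The state space: positive (in particular self-adjoint) operators of trace one satisfying the
conditions of `MemT1`. -/
structure State {D : Submodule ℂ H} (M : OStarAlgebra D) where
  /-- The density operator. -/
  op : H →L[ℂ] H
  memT1 : MemT1 M op
  positive : op.IsPositive
  trace_eq_one : trace (op : H →ₗ[ℂ] H) = 1

variable {D : Submodule ℂ H} {M : OStarAlgebra D}

/-- The expectation value `Tr (A ρ)`. -/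
def expect (A : M.alg) (ρ : State M) : ℂ :=
  trace (mulOp (A : Module.End ℂ D) ρ.op ρ.memT1.range_mem)

/-- The weak topology on the state space: the weakest topology for which all the functions
`ρ ↦ Tr (A ρ)`, `A ∈ M`, are continuous. -/
instance : TopologicalSpace (State M) :=
  ⨅ A : M.alg, TopologicalSpace.induced (expect A) inferInstance

theorem continuous_expect (A : M.alg) : Continuous (expect A) :=
  continuous_iInf_dom (i := A) continuous_induced_dom

/-- The real number valued function `a_Q (ρ) = Tr (A ρ)` on the open set `U`; the trace is real
for symmetric `A`. -/
def aQ (A : M.alg) (U : Opens (State M)) : C(U, ℝ) where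
  toFun ρ := (expect A ρ.1).re
  continuous_toFun :=
    Complex.continuous_re.comp ((continuous_expect A).comp continuous_subtype_val)

variable (M) in
/-- The sheaf of locally linear functions, as a subsheaf of the sheaf of continuous functions:
its sections over `U` are the functions on `U` which near each point of `U` coincide with the
function `a_Q` of an essentially self-adjoint `A ∈ M`. -/
def locallyLinear (U : Opens (State M)) : Set C(U, ℝ) :=
  {f | ∀ ρ : U, ∃ (V : Opens (State M)) (hVU : V ≤ U), ρ.1 ∈ V ∧
    ∃ A : M.alg, IsEssSelfAdjoint (A : Module.End ℂ D) ∧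
      ∀ σ : V, f ⟨σ.1, hVU σ.2⟩ = aQ A V σ}

/-! ### Dedekind cuts in the sheaf of rational numbers, and the orders they define -/

section Dedekind

variable {Y : Type*} [TopologicalSpace Y]

/-- The lower cut of the real number `f` defined to extent `Y`. It is a subsheaf of the sheaf of
locally constant rational functions on `Y`, with sections over `V` the `q < f|V`. -/
def lowerCut (f : C(Y, ℝ)) (V : Opens Y) : Set (LocallyConstant V ℚ) :=
  {q | ∀ y : V, ((q y : ℚ) : ℝ) < f y}

/-- The upper cut of the real number `f` defined to extent `Y`. -/
def upperCut (f : C(Y, ℝ)) (V : Opens Y) : Set (LocallyConstant V ℚ) :=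
  {q | ∀ y : V, f y < ((q y : ℚ) : ℝ)}

/-- `f ≤ g` iff the upper cut of `g` is contained in that of `f` and the lower cut of `f` is
contained in that of `g`. -/
def CutLE (f g : C(Y, ℝ)) : Prop :=
  ∀ V : Opens Y, upperCut g V ⊆ upperCut f V ∧ lowerCut f V ⊆ lowerCut g V

/-- `f < g` iff some rational number `q` defined to the full extent `Y` lies in the upper cut of
`f` and in the lower cut of `g`. -/
def CutLT (f g : C(Y, ℝ)) : Prop :=
  ∃ q : LocallyConstant (⊤ : Opens Y) ℚ, q ∈ upperCut f ⊤ ∧ q ∈ lowerCut g ⊤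

end Dedekind

/-! ### The orders obtained from the operators -/

/-- The operator order `≥ 0` on global sections of the sheaf of locally linear functions. -/
def SectionOpNonneg (f : C((⊤ : Opens (State M)), ℝ)) : Prop :=
  ∃ A : M.alg, IsEssSelfAdjoint (A : Module.End ℂ D) ∧ f = aQ A ⊤ ∧
    OpNonneg (A : Module.End ℂ D)

/-- The operator order `> 0` on global sections of the sheaf of locally linear functions. -/
def SectionOpPos (f : C((⊤ : Opens (State M)), ℝ)) : Prop :=
  ∃ A : M.alg, IsEssSelfAdjoint (A : Module.End ℂ D) ∧ f = aQ A ⊤ ∧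
    OpPos (A : Module.End ℂ D)

end QRNumber

end

/-! The link between functions on states and operators is convex geometry plus the spectral theorem.
A unit vector `u ∈ D` gives the pure state `|u⟩⟨u|`, whose expectation of `A` is `⟨u, A u⟩`; so
bounds on `a_Q` give bounds on the quadratic form. Conversely (`le_re_expect`), a state `ρ` is
compact and positive, so it has an orthonormal eigenbasis `b i` with eigenvalues `μ i ≥ 0` of sum
one. Since `ρ` maps into `D`, every `b i` with `μ i ≠ 0` lies in `D`, and `Tr A ρ = ∑ μ i ⟨b i, A b
i⟩` averages values of the form. This needs the trace to be independent of the basis, which is what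
the Hilbert–Schmidt theory is for.

The cut orders reduce to pointwise inequalities; for `>` a locally constant rational is constant
because the state space, being convex, is connected. Convexity also forces global sections to be
linear: two functions `a_Q` agreeing on a nonempty open set agree along segments leaving it, hence
everywhere, and connectedness does the rest. -/

noncomputable section
namespace QRNumber

universe u
open TopologicalSpace

/-! ### Trace class and Hilbert–Schmidt operators; spectral bases -/

section TraceClassTheory

variable {H : Type*} [NormedAddCommGroup H] [InnerProductSpace ℂ H] [CompleteSpace H]

/-- Douglas' lemma: a bounded operator dominated by another one factors through it. -/
theorem exists_eq_comp_of_norm_le (S T : H →L[ℂ] H) (h : ∀ x, ‖S x‖ ≤ ‖T x‖) :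
    ∃ W : H →L[ℂ] H, S = W ∘L T := by
  let K : Submodule ℂ H := (LinearMap.range (T : H →ₗ[ℂ] H)).topologicalClosure
  have hK : ∀ x, (T : H →ₗ[ℂ] H) x ∈ K := fun x =>
    Submodule.le_topologicalClosure _ ⟨x, rfl⟩
  let e : H →ₗ[ℂ] K := (T : H →ₗ[ℂ] H).codRestrict K hK
  have he : DenseRange e := by
    intro y
    rw [Topology.IsInducing.subtypeVal.closure_eq_preimage_closure_image]
    have : (Subtype.val '' Set.range e : Set H) = LinearMap.range (T : H →ₗ[ℂ] H) := by
      ext z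
      constructor
      · rintro ⟨_, ⟨x, rfl⟩, rfl⟩
        exact ⟨x, rfl⟩
      · rintro ⟨x, rfl⟩
        exact ⟨e x, ⟨x, rfl⟩, rfl⟩
    exact (congrArg (fun s => (y : H) ∈ closure s) this).mpr y.2
  have : CompleteSpace K := (Submodule.isClosed_topologicalClosure _).completeSpace_coe
  -- `T x ↦ S x` is well defined and contractive on the range of `T`; extend it to the closure `K`
  -- and by zero on `Kᗮ`.
  refine ⟨((S : H →ₗ[ℂ] H).extendOfNorm e) ∘L K.orthogonalProjectionOnto, ?_⟩
  ext x
  have h1 : K.orthogonalProjectionOnto (T x) = e x :=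
    Submodule.orthogonalProjectionOnto_mem_subspace_eq_self (e x)
  simp only [ContinuousLinearMap.comp_apply]
  rw [h1, LinearMap.extendOfNorm_eq he ⟨1, fun x => by simpa [e] using h x⟩]
  rfl

theorem norm_abs_apply (T : H →L[ℂ] H) (x : H) : ‖CFC.abs T x‖ = ‖T x‖ := by
  have h : CFC.abs T * CFC.abs T = star T * T := CFC.abs_mul_abs T
  have hs : star (CFC.abs T) = CFC.abs T := (CFC.abs_nonneg T).isSelfAdjoint
  have h1 : inner ℂ (CFC.abs T x) (CFC.abs T x) = inner ℂ (T x) (T x) := by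
    rw [← ContinuousLinearMap.adjoint_inner_right, ← ContinuousLinearMap.adjoint_inner_right T]
    have := congrArg (fun S : H →L[ℂ] H => inner ℂ x (S x)) h
    rw [← ContinuousLinearMap.star_eq_adjoint, hs]
    simpa [ContinuousLinearMap.star_eq_adjoint] using this
  rw [inner_self_eq_norm_sq_to_K, inner_self_eq_norm_sq_to_K] at h1
  have h2 : ‖CFC.abs T x‖ ^ 2 = ‖T x‖ ^ 2 := by exact_mod_cast h1
  exact (sq_eq_sq₀ (norm_nonneg _) (norm_nonneg _)).1 h2

/-- Douglas' lemma in both directions. A bounded `V` with `|T| = V T` is all that is needed later,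
so partial isometries are avoided. -/
theorem exists_polar (T : H →L[ℂ] H) :
    ∃ U V : H →L[ℂ] H, T = U ∘L CFC.abs T ∧ CFC.abs T = V ∘L T := by
  obtain ⟨U, hU⟩ := exists_eq_comp_of_norm_le T (CFC.abs T) fun x => (norm_abs_apply T x).ge
  obtain ⟨V, hV⟩ := exists_eq_comp_of_norm_le (CFC.abs T) T fun x => (norm_abs_apply T x).le
  exact ⟨U, V, hU, hV⟩

omit [CompleteSpace H] in
theorem hasSum_norm_inner_sq {ι : Type*} (e : HilbertBasis ι ℂ H) (x : H) :
    HasSum (fun i => ‖inner ℂ (e i) x‖ ^ 2) (‖x‖ ^ 2) := by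
  have h := (e.hasSum_inner_mul_inner x x).mapL Complex.reCLM
  have h2 : Complex.reCLM (inner ℂ x x) = ‖x‖ ^ 2 := by
    rw [inner_self_eq_norm_sq_to_K]
    simp [← Complex.ofReal_pow]
  rw [h2] at h
  convert h using 2 with i
  rw [← inner_conj_symm x (e i), Complex.conj_mul', ← Complex.ofReal_pow]
  rfl

/-- Hilbert–Schmidt operators. -/
def IsHilbertSchmidt (R : H →L[ℂ] H) : Prop :=
  Summable fun i => ‖R (onb H i)‖ ^ 2

variable {ι κ : Type*} (e : HilbertBasis ι ℂ H) (f : HilbertBasis κ ℂ H)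

omit [CompleteSpace H] in
-- By Parseval both sides sum the squared matrix coefficients. The double sum is symmetric in `R`
-- and its adjoint, which yields basis independence.
theorem summable_norm_sq_iff (R : H →L[ℂ] H) :
    (Summable fun i => ‖R (e i)‖ ^ 2) ↔
      Summable fun p : ι × κ => ‖inner ℂ (f p.2) (R (e p.1))‖ ^ 2 := by
  rw [summable_prod_of_nonneg fun p => by positivity]
  simp only [(hasSum_norm_inner_sq f _).tsum_eq]
  exact ⟨fun h => ⟨fun i => (hasSum_norm_inner_sq f _).summable, h⟩, fun h => h.2⟩

theorem summable_norm_sq_adjoint_iff (R : H →L[ℂ] H) :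
    (Summable fun i => ‖R (e i)‖ ^ 2) ↔ Summable fun j => ‖R.adjoint (f j)‖ ^ 2 := by
  rw [summable_norm_sq_iff e f, summable_norm_sq_iff f e, ← (Equiv.prodComm ι κ).summable_iff]
  refine summable_congr fun p => ?_
  simp only [Function.comp, Equiv.prodComm_apply, Prod.fst_swap, Prod.snd_swap,
    ContinuousLinearMap.adjoint_inner_right]
  rw [norm_inner_symm]

theorem isHilbertSchmidt_iff (R : H →L[ℂ] H) :
    IsHilbertSchmidt R ↔ Summable fun i => ‖R (e i)‖ ^ 2 := by
  rw [IsHilbertSchmidt, summable_norm_sq_adjoint_iff (onb H) (onb H),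
    summable_norm_sq_adjoint_iff e (onb H)]

theorem IsHilbertSchmidt.adjoint {R : H →L[ℂ] H} (h : IsHilbertSchmidt R) :
    IsHilbertSchmidt R.adjoint :=
  (summable_norm_sq_adjoint_iff (onb H) (onb H) R).1 h

theorem IsHilbertSchmidt.comp_left {R : H →L[ℂ] H} (h : IsHilbertSchmidt R) (W : H →L[ℂ] H) :
    IsHilbertSchmidt (W ∘L R) := by
  refine Summable.of_nonneg_of_le (fun i => by positivity) (fun i => ?_)
    (Summable.mul_left (‖W‖ ^ 2) h)
  rw [← mul_pow]
  gcongr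
  exact W.le_opNorm _

/-- For Hilbert–Schmidt operators `A`, `B` the trace of `A B` in any orthonormal basis is given by
the trace of `B A` in any other one. -/
theorem hasSum_inner_comp {A B : H →L[ℂ] H} (hA : IsHilbertSchmidt A) (hB : IsHilbertSchmidt B) :
    HasSum (fun i => inner ℂ (e i) (A (B (e i)))) (∑' j, inner ℂ (f j) (B (A (f j)))) := by
  have h1 := (summable_norm_sq_iff e f _).1 ((isHilbertSchmidt_iff e _).1 hA.adjoint)
  have h2 := (summable_norm_sq_iff e f _).1 ((isHilbertSchmidt_iff e _).1 hB)
  -- `F` is absolutely summable as a product of two square summable families; its row and column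
  -- sums are the two traces.
  let F : ι × κ → ℂ := fun p =>
    inner ℂ (A.adjoint (e p.1)) (f p.2) * inner ℂ (f p.2) (B (e p.1))
  have hF : Summable F := by
    refine Summable.of_norm_bounded (h1.add h2) fun p => ?_
    simp only [F, norm_mul]
    rw [norm_inner_symm]
    nlinarith [sq_nonneg (‖inner ℂ (f p.2) (A.adjoint (e p.1))‖ - ‖inner ℂ (f p.2) (B (e p.1))‖),
      sq_nonneg (‖inner ℂ (f p.2) (A.adjoint (e p.1))‖),
      sq_nonneg (‖inner ℂ (f p.2) (B (e p.1))‖)]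
  have hr : ∀ i, HasSum (fun j => F (i, j)) (inner ℂ (e i) (A (B (e i)))) := fun i => by
    have h := f.hasSum_inner_mul_inner (A.adjoint (e i)) (B (e i))
    rwa [ContinuousLinearMap.adjoint_inner_left A (B (e i)) (e i)] at h
  have hc : ∀ j, HasSum (fun i => F (i, j)) (inner ℂ (f j) (B (A (f j)))) := fun j => by
    have h := e.hasSum_inner_mul_inner (B.adjoint (f j)) (A (f j))
    rw [ContinuousLinearMap.adjoint_inner_left B (A (f j)) (f j)] at h
    refine (congrArg (HasSum · _) (funext fun i => ?_)).mpr h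
    change inner ℂ (A.adjoint (e i)) (f j) * inner ℂ (f j) (B (e i)) = _
    rw [ContinuousLinearMap.adjoint_inner_left, ContinuousLinearMap.adjoint_inner_left, mul_comm]
  have h3 := hF.hasSum.prod_fiberwise hr
  have h4 := ((Equiv.prodComm κ ι).hasSum_iff.2 hF.hasSum).prod_fiberwise hc
  rwa [h4.tsum_eq]

/-- The trace class condition in terms of Hilbert–Schmidt operators. -/
theorem isTraceClass_iff {T : H →L[ℂ] H} :
    IsTraceClass T ↔ ∃ A B, IsHilbertSchmidt A ∧ IsHilbertSchmidt B ∧ T = A ∘L B := by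
  obtain ⟨U, V, hU, hV⟩ := exists_polar T
  constructor
  · intro h
    set R := CFC.sqrt (CFC.abs T)
    have hRR : R * R = CFC.abs T := CFC.sqrt_mul_sqrt_self _ (CFC.abs_nonneg T)
    have hs : star R = R := (CFC.sqrt_nonneg (CFC.abs T)).isSelfAdjoint
    have hR : IsHilbertSchmidt R := by
      refine (summable_congr fun i => ?_).1 h
      rw [← hRR, mul_apply_eq_comp]
      nth_rw 1 [← hs]
      rw [ContinuousLinearMap.star_eq_adjoint, ContinuousLinearMap.adjoint_inner_right,
        inner_self_eq_norm_sq_to_K]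
      simp [← Complex.ofReal_pow]
    -- With `R = √|T|`, `T = U |T| = (U R) R`.
    refine ⟨U ∘L R, R, hR.comp_left U, hR, ?_⟩
    rw [ContinuousLinearMap.comp_assoc]
    change T = U ∘L (R * R)
    rwa [hRR]
  · rintro ⟨A, B, hA, hB, hT⟩
    have := (hasSum_inner_comp (onb H) (onb H) (hA.comp_left V) hB).mapL Complex.reCLM
    refine this.summable.congr fun i => ?_
    rw [hV, hT]
    rfl

theorem IsTraceClass.comp_left {T : H →L[ℂ] H} (h : IsTraceClass T) (W : H →L[ℂ] H) :
    IsTraceClass (W ∘L T) := by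
  obtain ⟨A, B, hA, hB, rfl⟩ := isTraceClass_iff.1 h
  exact isTraceClass_iff.2 ⟨W ∘L A, B, hA.comp_left W, hB, rfl⟩

/-- The trace of a trace class operator can be computed in any orthonormal basis. -/
theorem IsTraceClass.hasSum_trace {T : H →L[ℂ] H} (h : IsTraceClass T) :
    HasSum (fun i => inner ℂ (e i) (T (e i))) (trace (T : H →ₗ[ℂ] H)) := by
  obtain ⟨A, B, hA, hB, rfl⟩ := isTraceClass_iff.1 h
  have h1 := hasSum_inner_comp e (onb H) hA hB
  have h2 := hasSum_inner_comp (onb H) (onb H) hA hB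
  rw [← h2.tsum_eq] at h1
  exact h1

/-- Writing `|S + T| = V S + V T` replaces a triangle inequality for absolute values: both summands
have convergent traces. -/
theorem IsTraceClass.add {S T : H →L[ℂ] H} (hS : IsTraceClass S) (hT : IsTraceClass T) :
    IsTraceClass (S + T) := by
  obtain ⟨-, V, -, hV⟩ := exists_polar (S + T)
  have h1 := ((hS.comp_left V).hasSum_trace (onb H)).add ((hT.comp_left V).hasSum_trace (onb H))
  refine (h1.mapL Complex.reCLM).summable.congr fun i => ?_
  rw [hV]
  simp

theorem IsTraceClass.smul {T : H →L[ℂ] H} (hT : IsTraceClass T) (c : ℂ) :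
    IsTraceClass (c • T) := by
  have := hT.comp_left (c • ContinuousLinearMap.id ℂ H)
  rwa [ContinuousLinearMap.smul_comp, ContinuousLinearMap.id_comp] at this

theorem IsTraceClassMap.hasSum_trace {L : H →ₗ[ℂ] H} (h : IsTraceClassMap L) :
    HasSum (fun i => inner ℂ (e i) (L (e i))) (trace L) := by
  obtain ⟨S, rfl, hS⟩ := h
  exact hS.hasSum_trace e

theorem IsTraceClassMap.add {L K : H →ₗ[ℂ] H} (hL : IsTraceClassMap L) (hK : IsTraceClassMap K) :
    IsTraceClassMap (L + K) := by
  obtain ⟨S, rfl, hS⟩ := hL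
  obtain ⟨T, rfl, hT⟩ := hK
  exact ⟨S + T, rfl, hS.add hT⟩

theorem IsTraceClassMap.smul {L : H →ₗ[ℂ] H} (hL : IsTraceClassMap L) (c : ℂ) :
    IsTraceClassMap (c • L) := by
  obtain ⟨S, rfl, hS⟩ := hL
  exact ⟨c • S, rfl, hS.smul c⟩

theorem trace_add {L K : H →ₗ[ℂ] H} (hL : IsTraceClassMap L) (hK : IsTraceClassMap K) :
    trace (L + K) = trace L + trace K := by
  rw [← ((hL.hasSum_trace (onb H)).add (hK.hasSum_trace (onb H))).tsum_eq]
  simp [trace]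

theorem trace_smul (L : H →ₗ[ℂ] H) (c : ℂ) : trace (c • L) = c * trace L := by
  simp [trace, tsum_mul_left]

theorem isTraceClass_rankOne (v : H) {u : H} (hu : ‖u‖ = 1) :
    IsTraceClass (InnerProductSpace.rankOne ℂ v u) := by
  have hHS : ∀ w : H, IsHilbertSchmidt (InnerProductSpace.rankOne ℂ w u) := fun w => by
    refine ((hasSum_norm_inner_sq (onb H) u).mul_right (‖w‖ ^ 2)).summable.congr fun i => ?_
    rw [InnerProductSpace.rankOne_apply, norm_smul, mul_pow, norm_inner_symm]
  refine isTraceClass_iff.2 ⟨_, _, hHS v, hHS u, ?_⟩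
  ext x
  simp [inner_self_eq_norm_sq_to_K, hu]

theorem trace_rankOne (v u : H) :
    trace (InnerProductSpace.rankOne ℂ v u : H →ₗ[ℂ] H) = inner ℂ u v := by
  rw [← (onb H).tsum_inner_mul_inner u v]
  simp [trace]

theorem IsHilbertSchmidt.isCompactOperator {R : H →L[ℂ] H} (h : IsHilbertSchmidt R) :
    IsCompactOperator R := by
  classical
  -- Finite rank truncations `P_s R`, with `P_s` the projection onto the span of the basis vectors
  -- in `s`; the error is bounded by the tail of the Hilbert–Schmidt sum of the adjoint.
  let F : Finset (basisSet H) → H →L[ℂ] H := fun s =>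
    ∑ i ∈ s, InnerProductSpace.rankOne ℂ (onb H i) (R.adjoint (onb H i))
  have hF : Filter.Tendsto F Filter.atTop (nhds R) := by
    have htail := tendsto_tsum_compl_atTop_zero fun i => ‖R.adjoint (onb H i)‖ ^ 2
    have hsq := htail.sqrt
    rw [Real.sqrt_zero] at hsq
    rw [tendsto_iff_norm_sub_tendsto_zero]
    refine squeeze_zero (fun _ => norm_nonneg _) (fun s => ?_) hsq
    refine ContinuousLinearMap.opNorm_le_bound _ (Real.sqrt_nonneg _) fun x => ?_
    have hco : ∀ i, inner ℂ (onb H i) ((F s - R) x) =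
        if i ∈ s then 0 else - inner ℂ (R.adjoint (onb H i)) x := fun i => by
      simp only [F, sub_apply, sum_apply,
        InnerProductSpace.rankOne_apply, inner_sub_right, inner_sum, inner_smul_right,
        orthonormal_iff_ite.1 (onb H).orthonormal, ContinuousLinearMap.adjoint_inner_left]
      split_ifs with hi <;> simp [hi]
    have h1 := hasSum_norm_inner_sq (onb H) ((F s - R) x)
    have hadj : Summable fun i => ‖R.adjoint (onb H i)‖ ^ 2 := h.adjoint
    have h2 : ‖(F s - R) x‖ ^ 2 ≤ (∑' i : {i // i ∉ s}, ‖R.adjoint (onb H i)‖ ^ 2) * ‖x‖ ^ 2 := by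
      rw [← h1.tsum_eq, ← tsum_mul_right]
      have h3 : ∑' i, ‖inner ℂ (onb H i) ((F s - R) x)‖ ^ 2 =
          ∑' i : {i // i ∉ s}, ‖inner ℂ (onb H i) ((F s - R) x)‖ ^ 2 := by
        refine (tsum_subtype_eq_of_support_subset (s := {i | i ∉ s}) fun i hi => ?_).symm
        intro his
        apply hi
        simp only [hco]
        simp [show i ∈ s from his]
      rw [h3]
      refine Summable.tsum_le_tsum (fun i => ?_) (h1.summable.subtype _)
        ((hadj.subtype {i | i ∉ s}).mul_right _)
      rw [hco, if_neg i.2, norm_neg, ← mul_pow]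
      gcongr
      exact norm_inner_le_norm _ _
    calc ‖(F s - R) x‖ = √(‖(F s - R) x‖ ^ 2) := (Real.sqrt_sq (norm_nonneg _)).symm
      _ ≤ √((∑' i : {i // i ∉ s}, ‖R.adjoint (onb H i)‖ ^ 2) * ‖x‖ ^ 2) := Real.sqrt_le_sqrt h2
      _ = _ := by rw [Real.sqrt_mul' _ (by positivity), Real.sqrt_sq (norm_nonneg _)]
  refine isCompactOperator_of_tendsto hF (Filter.Eventually.of_forall fun s => ?_)
  have hr : ∀ v u : H, IsCompactOperator (InnerProductSpace.rankOne ℂ v u) := fun v u => by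
    rw [InnerProductSpace.rankOne_def']
    exact (isCompactOperator_of_locallyCompactSpace_rng
      (ContinuousLinearMap.toSpanSingleton ℂ v)).comp_clm (innerSL ℂ u)
  exact (compactOperator (RingHom.id ℂ) H H).sum_mem
    (t := s) (f := fun i => InnerProductSpace.rankOne ℂ (onb H i) (R.adjoint (onb H i)))
    fun i _ => hr _ _

theorem IsTraceClass.isCompactOperator {T : H →L[ℂ] H} (h : IsTraceClass T) :
    IsCompactOperator T := by
  obtain ⟨A, B, hA, -, rfl⟩ := isTraceClass_iff.1 h
  exact hA.isCompactOperator.comp_clm B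

/-- Orthonormal bases of the members of a complete orthogonal family combine to a Hilbert basis. -/
theorem exists_hilbertBasis_of_orthogonalFamily {H : Type u} [NormedAddCommGroup H]
    [InnerProductSpace ℂ H] [CompleteSpace H] {α : Type} (E : α → Submodule ℂ H)
    (hc : ∀ a, IsClosed (E a : Set H))
    (hE : OrthogonalFamily ℂ (fun a => E a) fun a => (E a).subtypeₗᵢ)
    (hbot : (⨆ a, E a)ᗮ = ⊥) :
    ∃ (ι : Type u) (b : HilbertBasis ι ℂ H), ∀ i, ∃ a, b i ∈ E a := by
  have : ∀ a, CompleteSpace (E a) := fun a => (hc a).completeSpace_coe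
  have hb : ∀ a, ∃ (w : Set (E a)), Nonempty (HilbertBasis w ℂ (E a)) := fun a => by
    obtain ⟨w, b, -⟩ := exists_hilbertBasis ℂ (E a)
    exact ⟨w, ⟨b⟩⟩
  choose w hb using hb
  have b := fun a => (hb a).some
  let v : (Σ a, w a) → H := fun p => (b p.1 p.2 : H)
  have hv : Orthonormal ℂ v := hE.orthonormal_sigma_orthonormal
    (v_family := fun a => b a) fun a => (b a).orthonormal
  have hsp : (Submodule.span ℂ (Set.range v))ᗮ = ⊥ := by
    rw [eq_bot_iff, ← hbot, ← Submodule.iInf_orthogonal]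
    refine le_iInf fun a x hx => ?_
    have h0 : (E a).orthogonalProjectionOnto x = 0 := by
      refine (b a).repr.injective ?_
      ext i
      rw [HilbertBasis.repr_apply_apply, map_zero,
        Submodule.inner_orthogonalProjectionOnto_eq_of_mem_left]
      exact (Submodule.mem_orthogonal _ _).1 hx _ (Submodule.subset_span ⟨⟨a, i⟩, rfl⟩)
    rwa [Submodule.orthogonalProjectionOnto_eq_zero_iff] at h0
  have hmem : ∀ p, ∃ a, v p ∈ E a := fun p => ⟨p.1, (b p.1 p.2).2⟩
  rw [← HilbertBasis.coe_mkOfOrthogonalEqBot hv hsp] at hmem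
  exact ⟨_, HilbertBasis.mkOfOrthogonalEqBot hv hsp, hmem⟩

/-- A compact symmetric operator has an orthonormal basis of eigenvectors. -/
theorem exists_hilbertBasis_eigenvectors {H : Type u} [NormedAddCommGroup H]
    [InnerProductSpace ℂ H] [CompleteSpace H] {T : H →L[ℂ] H} (hT : IsCompactOperator T)
    (hs : (T : H →ₗ[ℂ] H).IsSymmetric) :
    ∃ (ι : Type u) (b : HilbertBasis ι ℂ H), ∀ i, ∃ μ : ℂ, T (b i) = μ • b i := by
  have hc : ∀ μ : ℂ, IsClosed (Module.End.eigenspace (T : H →ₗ[ℂ] H) μ : Set H) := fun μ => by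
    have : (Module.End.eigenspace (T : H →ₗ[ℂ] H) μ : Set H) = {x | T x = μ • x} := by
      ext x
      exact Module.End.mem_eigenspace_iff
    rw [this]
    exact isClosed_eq T.continuous (continuous_const_smul μ)
  obtain ⟨ι, b, hb⟩ := exists_hilbertBasis_of_orthogonalFamily _ hc hs.orthogonalFamily_eigenspaces
    (ContinuousLinearMap.orthogonalComplement_iSup_eigenspaces_eq_bot hT hs)
  exact ⟨ι, b, fun i => (hb i).imp fun μ h => Module.End.mem_eigenspace_iff.1 h⟩

end TraceClassTheory

/-! ### Convexity and connectedness of the state space; expectation values -/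

section StateSpace

variable {H : Type*} [NormedAddCommGroup H] [InnerProductSpace ℂ H] [CompleteSpace H]
  {D : Submodule ℂ H} {M : OStarAlgebra D}

theorem memT1_of_adjoint_eq {T : H →L[ℂ] H} (hadj : T.adjoint = T) (hT : IsTraceClass T)
    (hr : ∀ x, T x ∈ D) (hmul : ∀ A ∈ M.alg, IsTraceClassMap (mulOp A T hr)) : MemT1 M T where
  traceClass := hT
  range_mem := hr
  adjoint_range_mem := fun x => by rw [hadj]; exact hr x
  mul_traceClass := hmul
  mul_adjoint_traceClass := by simpa only [hadj] using hmul

omit [CompleteSpace H] in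
theorem mulOp_smul_add_smul (A : Module.End ℂ D) (a b : ℂ) (S T : H →L[ℂ] H)
    (hS : ∀ x, S x ∈ D) (hT : ∀ x, T x ∈ D) (h : ∀ x, (a • S + b • T) x ∈ D) :
    mulOp A (a • S + b • T) h = a • mulOp A S hS + b • mulOp A T hT := by
  ext x
  have : (⟨(a • S + b • T) x, h x⟩ : D) = a • ⟨S x, hS x⟩ + b • ⟨T x, hT x⟩ := rfl
  change ((A ⟨(a • S + b • T) x, h x⟩ : D) : H) = _
  rw [this, map_add, map_smul, map_smul]
  rfl

/-- The state `(1 - t) ρ + t σ`. -/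
def State.mix (ρ σ : State M) (t : unitInterval) : State M where
  op := ((1 - t : ℝ) : ℂ) • ρ.op + ((t : ℝ) : ℂ) • σ.op
  positive := by
    refine (ρ.positive.smul_of_nonneg ?_).add (σ.positive.smul_of_nonneg ?_)
    · exact_mod_cast unitInterval.one_minus_nonneg t
    · exact_mod_cast t.2.1
  memT1 := by
    have hr : ∀ x, (((1 - t : ℝ) : ℂ) • ρ.op + ((t : ℝ) : ℂ) • σ.op) x ∈ D := fun x =>
      D.add_mem (D.smul_mem _ (ρ.memT1.range_mem x)) (D.smul_mem _ (σ.memT1.range_mem x))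
    refine memT1_of_adjoint_eq ?_
      ((ρ.memT1.traceClass.smul _).add (σ.memT1.traceClass.smul _)) hr fun A hA => ?_
    · rw [map_add, map_smulₛₗ, map_smulₛₗ, Complex.conj_ofReal, Complex.conj_ofReal,
        ρ.positive.isSelfAdjoint.adjoint_eq, σ.positive.isSelfAdjoint.adjoint_eq]
    · rw [mulOp_smul_add_smul A _ _ _ _ ρ.memT1.range_mem σ.memT1.range_mem]
      exact ((ρ.memT1.mul_traceClass A hA).smul _).add ((σ.memT1.mul_traceClass A hA).smul _)
  trace_eq_one := by
    have h := trace_add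
      (IsTraceClassMap.smul ⟨ρ.op, rfl, ρ.memT1.traceClass⟩ ((1 - t : ℝ) : ℂ))
      (IsTraceClassMap.smul ⟨σ.op, rfl, σ.memT1.traceClass⟩ ((t : ℝ) : ℂ))
    rw [trace_smul, trace_smul, ρ.trace_eq_one, σ.trace_eq_one] at h
    refine Eq.trans h ?_
    push_cast
    ring

theorem expect_mix (A : M.alg) (ρ σ : State M) (t : unitInterval) :
    expect A (ρ.mix σ t) = ((1 - t : ℝ) : ℂ) * expect A ρ + ((t : ℝ) : ℂ) * expect A σ := by
  have h := mulOp_smul_add_smul (A : Module.End ℂ D) ((1 - t : ℝ) : ℂ) ((t : ℝ) : ℂ) ρ.op σ.op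
    ρ.memT1.range_mem σ.memT1.range_mem (ρ.mix σ t).memT1.range_mem
  refine (congrArg trace h).trans ?_
  rw [trace_add ((ρ.memT1.mul_traceClass A A.2).smul _) ((σ.memT1.mul_traceClass A A.2).smul _),
    trace_smul, trace_smul]
  rfl

theorem State.mix_zero (ρ σ : State M) : ρ.mix σ 0 = ρ := by
  obtain ⟨_, _, _, _⟩ := ρ
  simp [State.mix]

theorem State.mix_one (ρ σ : State M) : ρ.mix σ 1 = σ := by
  obtain ⟨_, _, _, _⟩ := σ
  simp [State.mix]

theorem State.continuous_mix (ρ σ : State M) : Continuous (ρ.mix σ) := by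
  refine continuous_iInf_rng.2 fun A => continuous_induced_rng.2 ?_
  simp only [Function.comp_def, expect_mix]
  fun_prop

instance : PreconnectedSpace (State M) where
  isPreconnected_univ := isPreconnected_of_forall_pair fun ρ _ σ _ =>
    ⟨Set.range (ρ.mix σ), Set.subset_univ _, ⟨0, ρ.mix_zero σ⟩, ⟨1, ρ.mix_one σ⟩,
      isPreconnected_range (ρ.continuous_mix σ)⟩

omit [CompleteSpace H] in
theorem mulOp_rankOne (A : Module.End ℂ D) (u : D)
    (h : ∀ x, InnerProductSpace.rankOne ℂ (u : H) (u : H) x ∈ D) :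
    mulOp A (InnerProductSpace.rankOne ℂ (u : H) (u : H)) h =
      (InnerProductSpace.rankOne ℂ (A u : H) (u : H) : H →ₗ[ℂ] H) := by
  ext x
  have : (⟨InnerProductSpace.rankOne ℂ (u : H) (u : H) x, h x⟩ : D) = inner ℂ (u : H) x • u := rfl
  change ((A ⟨InnerProductSpace.rankOne ℂ (u : H) (u : H) x, h x⟩ : D) : H) = _
  rw [this, map_smul]
  rfl

/-- The pure state given by a unit vector in the domain. -/
def pureState (M : OStarAlgebra D) (u : D) (hu : ‖(u : H)‖ = 1) : State M where
  op := InnerProductSpace.rankOne ℂ (u : H) (u : H)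
  positive := InnerProductSpace.isPositive_rankOne_self _
  memT1 := by
    have hr : ∀ x, InnerProductSpace.rankOne ℂ (u : H) (u : H) x ∈ D := fun x =>
      D.smul_mem _ u.2
    refine memT1_of_adjoint_eq (InnerProductSpace.adjoint_rankOne _ _) (isTraceClass_rankOne _ hu)
      hr fun A _ => ?_
    rw [mulOp_rankOne]
    exact ⟨_, rfl, isTraceClass_rankOne _ hu⟩
  trace_eq_one := by
    rw [trace_rankOne, inner_self_eq_norm_sq_to_K, hu]
    simp

theorem expect_pureState (A : M.alg) (u : D) (hu : ‖(u : H)‖ = 1) :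
    expect A (pureState M u hu) = inner ℂ (u : H) ((A : Module.End ℂ D) u : H) := by
  refine (congrArg trace (mulOp_rankOne (A : Module.End ℂ D) u _)).trans ?_
  rw [trace_rankOne]

open scoped ComplexOrder in
/-- A lower bound of the quadratic form of `A` is a lower bound of its expectation values. -/
theorem le_re_expect (A : M.alg) {q : ℝ}
    (hq : ∀ u : D, ‖(u : H)‖ = 1 → q ≤ (inner ℂ (u : H) ((A : Module.End ℂ D) u : H)).re)
    (ρ : State M) : q ≤ (expect A ρ).re := by
  obtain ⟨ι, b, hb⟩ := exists_hilbertBasis_eigenvectors ρ.memT1.traceClass.isCompactOperator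
    ρ.positive.isSymmetric
  have h1 := ((ρ.memT1.traceClass.hasSum_trace b).mapL Complex.reCLM).mul_left q
  have h2 := ((ρ.memT1.mul_traceClass A A.2).hasSum_trace b).mapL Complex.reCLM
  rw [ρ.trace_eq_one] at h1
  have h3 := hasSum_le (fun i => ?_) h1 h2
  · simpa [expect] using h3
  obtain ⟨μ, hμ⟩ := hb i
  have hnorm : ‖b i‖ = 1 := b.orthonormal.1 i
  have hin : inner ℂ (b i) (ρ.op (b i)) = μ := by
    rw [hμ, inner_smul_right, inner_self_eq_norm_sq_to_K, hnorm]
    simp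
  have hpos : 0 ≤ μ := hin ▸ ρ.positive.inner_nonneg_right (b i)
  change q * (inner ℂ (b i) (ρ.op (b i))).re ≤
    (inner ℂ (b i) ((A : Module.End ℂ D) ⟨ρ.op (b i), ρ.memT1.range_mem _⟩ : H)).re
  rw [hin]
  -- Kernel vectors need not lie in `D`, but contribute zero; any other eigenvector is `μ⁻¹ • ρ (b
  -- i)`, hence in `D`.
  by_cases h0 : μ = 0
  · have : (⟨ρ.op (b i), ρ.memT1.range_mem _⟩ : D) = 0 := by
      ext
      simp [hμ, h0]
    simp [this, h0]
  · have hbD : b i ∈ D := by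
      have := D.smul_mem μ⁻¹ (ρ.memT1.range_mem (b i))
      rwa [hμ, smul_smul, inv_mul_cancel₀ h0, one_smul] at this
    have : (⟨ρ.op (b i), ρ.memT1.range_mem _⟩ : D) = μ • ⟨b i, hbD⟩ := Subtype.ext hμ
    rw [this, map_smul, Submodule.coe_smul, inner_smul_right, Complex.mul_re,
      ← (Complex.le_def.1 hpos).2, Complex.zero_im, zero_mul, sub_zero, mul_comm]
    exact mul_le_mul_of_nonneg_left (hq ⟨b i, hbD⟩ hnorm) (Complex.le_def.1 hpos).1

omit [CompleteSpace H] in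
theorem opNonneg_iff_unit {A : Module.End ℂ D} :
    OpNonneg A ↔ ∀ u : D, ‖(u : H)‖ = 1 → 0 ≤ (inner ℂ (u : H) (A u : H)).re := by
  refine ⟨fun h u _ => h u, fun h u => ?_⟩
  by_cases h0 : (u : H) = 0
  · simp [h0]
  have hn : ‖(u : H)‖ ≠ 0 := norm_ne_zero_iff.2 h0
  have h1 := h (((‖(u : H)‖⁻¹ : ℝ) : ℂ) • u) (by
    rw [Submodule.coe_smul, norm_smul, Complex.norm_real, norm_inv, norm_norm, inv_mul_cancel₀ hn])
  rw [map_smul, Submodule.coe_smul, Submodule.coe_smul, inner_smul_left, inner_smul_right,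
    Complex.conj_ofReal, Complex.re_ofReal_mul, Complex.re_ofReal_mul, ← mul_assoc] at h1
  exact nonneg_of_mul_nonneg_right h1 (by positivity)

theorem opNonneg_iff_expect (A : M.alg) :
    OpNonneg (A : Module.End ℂ D) ↔ ∀ ρ : State M, 0 ≤ (expect A ρ).re := by
  rw [opNonneg_iff_unit]
  refine ⟨fun h ρ => le_re_expect A h ρ, fun h u hu => ?_⟩
  rw [← expect_pureState A u hu]
  exact h _

theorem opPos_iff_expect (A : M.alg) :
    OpPos (A : Module.End ℂ D) ↔ ∃ q : ℚ, 0 < q ∧ ∀ ρ : State M, (q : ℝ) < (expect A ρ).re := by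
  constructor
  · rintro ⟨q, hq, h⟩
    -- Halving `q` restores the strict inequality, as averaging is only used in its non-strict form.
    refine ⟨q / 2, half_pos hq, fun ρ => lt_of_lt_of_le ?_ (le_re_expect A (fun u hu => (h u hu).le) ρ)⟩
    exact_mod_cast half_lt_self hq
  · rintro ⟨q, hq, h⟩
    refine ⟨q, hq, fun u hu => ?_⟩
    rw [← expect_pureState A u hu]
    exact h _

/-- If two members of the algebra have the same (real) expectation values on a nonempty open set of
states then they have the same ones everywhere. -/
theorem re_expect_eq_of_eqOn {A B : M.alg} {V : Set (State M)} (hV : IsOpen V)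
    (hne : V.Nonempty) (h : ∀ ρ ∈ V, (expect A ρ).re = (expect B ρ).re) (σ : State M) :
    (expect A σ).re = (expect B σ).re := by
  obtain ⟨ρ, hρ⟩ := hne
  have hev : ∀ᶠ t : unitInterval in nhds 0, ρ.mix σ t ∈ V :=
    (ρ.continuous_mix σ).continuousAt.eventually_mem (hV.mem_nhds (by rwa [State.mix_zero]))
  -- A mixture with some `t > 0` lies in `V`; affineness in `t` then transfers equality from `ρ` and
  -- the mixture to `σ`.
  have hfreq : ∃ᶠ t : unitInterval in nhds 0, 0 < t := by
    rw [Filter.frequently_iff_neBot]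
    change (nhdsWithin (0 : unitInterval) (Set.Ioi 0)).NeBot
    exact nhdsGT_neBot_of_exists_gt ⟨1, zero_lt_one⟩
  obtain ⟨t, ht0, htV⟩ := (hfreq.and_eventually hev).exists
  have h1 := h _ htV
  rw [expect_mix, expect_mix, Complex.add_re, Complex.add_re] at h1
  simp only [Complex.re_ofReal_mul, h ρ hρ] at h1
  have : (0 : ℝ) < t := ht0
  exact mul_left_cancel₀ this.ne' (add_left_cancel h1)

/-- On a nonempty state space every global locally linear function is linear. -/
theorem exists_eq_aQ_of_mem_locallyLinear [Nonempty (State M)]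
    {f : C((⊤ : Opens (State M)), ℝ)} (hf : f ∈ locallyLinear M ⊤) :
    ∃ A : M.alg, IsEssSelfAdjoint (A : Module.End ℂ D) ∧ f = aQ A ⊤ := by
  have hloc : ∀ ρ : State M, ∃ (V : Set (State M)) (A : M.alg), IsOpen V ∧ ρ ∈ V ∧
      IsEssSelfAdjoint (A : Module.End ℂ D) ∧ ∀ σ ∈ V, f ⟨σ, trivial⟩ = (expect A σ).re := by
    intro ρ
    obtain ⟨V, hV, hρ, A, hA, h⟩ := hf ⟨ρ, trivial⟩
    exact ⟨V, A, V.isOpen, hρ, hA, fun σ hσ => h ⟨σ, hσ⟩⟩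
  obtain ⟨ρ₀⟩ := ‹Nonempty (State M)›
  obtain ⟨V₀, A, hV₀, hρ₀, hA, hfA⟩ := hloc ρ₀
  refine ⟨A, hA, ?_⟩
  -- `S`, the interior of the set where `f` equals the expectation of `A`, is shown to be clopen.
  -- Near a limit point `f` is given by some `B`, which agrees with `A` on an open overlap and so
  -- everywhere.
  let S : Set (State M) := {ρ | ∀ᶠ σ in nhds ρ, f ⟨σ, trivial⟩ = (expect A σ).re}
  have hSo : IsOpen S := isOpen_setOfPred_eventually_nhds
  have hSc : IsClosed S := by
    rw [← isOpen_compl_iff, isOpen_iff_mem_nhds]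
    intro ρ hρ
    obtain ⟨V, B, hV, hρV, -, hfB⟩ := hloc ρ
    refine Filter.mem_of_superset (hV.mem_nhds hρV) fun τ hτ hτS => hρ ?_
    have hAB := re_expect_eq_of_eqOn (A := A) (B := B) (hSo.inter hV) ⟨τ, hτS, hτ⟩
      fun σ hσ => by rw [← hfB σ hσ.2, ← hσ.1.self_of_nhds]
    filter_upwards [hV.mem_nhds hρV] with σ hσ
    rw [hfB σ hσ, hAB]
  have hS : S = Set.univ := IsClopen.eq_univ ⟨hSc, hSo⟩
    ⟨ρ₀, Filter.mem_of_superset (hV₀.mem_nhds hρ₀) hfA⟩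
  ext ρ
  have : ρ.1 ∈ S := hS ▸ Set.mem_univ _
  exact this.self_of_nhds

end StateSpace

/-! ### Dedekind cuts compared with zero -/

section Cuts

variable {Y : Type*} [TopologicalSpace Y] {f : C(Y, ℝ)}

theorem cutLE_zero_iff : CutLE 0 f ↔ ∀ y, 0 ≤ f y := by
  constructor
  · intro h y
    by_contra! hy
    obtain ⟨q, hq, hq0⟩ := exists_rat_btwn hy
    -- If `f y < q < 0`, the constant `q` is in the upper cut of `f` over `{f < q}`, but not in that
    -- of zero.
    let V : Opens Y := ⟨f ⁻¹' Set.Iio (q : ℝ), isOpen_Iio.preimage f.continuous⟩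
    have h1 : LocallyConstant.const V q ∈ upperCut f V := fun v => v.2
    have h2 : (0 : ℝ) < q := (h V).1 h1 ⟨y, hq⟩
    exact absurd h2 hq0.not_gt
  · intro h V
    exact ⟨fun q hq y => (h y).trans_lt (hq y), fun q hq y => (hq y).trans_le (h y)⟩

theorem cutLT_zero_iff [PreconnectedSpace Y] :
    CutLT 0 f ↔ ∃ q : ℚ, 0 < q ∧ ∀ y, (q : ℝ) < f y := by
  constructor
  · rintro ⟨q, hq0, hq⟩
    have : PreconnectedSpace (⊤ : Opens Y) := Subtype.preconnectedSpace isPreconnected_univ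
    rcases isEmpty_or_nonempty Y with hY | ⟨⟨y₀⟩⟩
    · exact ⟨1, one_pos, fun y => hY.elim y⟩
    · have hc : ∀ y, q y = q ⟨y₀, trivial⟩ := fun y => q.apply_eq_of_preconnectedSpace _ _
      refine ⟨q ⟨y₀, trivial⟩, ?_, fun y => ?_⟩
      · have h : (0 : ℝ) < (q ⟨y₀, trivial⟩ : ℚ) := hq0 ⟨y₀, trivial⟩
        exact_mod_cast h
      · rw [← hc ⟨y, trivial⟩]
        exact hq ⟨y, trivial⟩
  · rintro ⟨q, hq0, hq⟩
    refine ⟨LocallyConstant.const _ q, fun y => ?_, fun y => hq y⟩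
    have h : (0 : ℝ) < q := by exact_mod_cast hq0
    exact h

end Cuts

/-! ### Comparison of the two orders -/

section Orders

variable {H : Type*} [NormedAddCommGroup H] [InnerProductSpace ℂ H] [CompleteSpace H]
  {D : Submodule ℂ H} {M : OStarAlgebra D}

theorem cutLE_zero_aQ_iff (A : M.alg) :
    CutLE 0 (aQ A ⊤) ↔ OpNonneg (A : Module.End ℂ D) := by
  rw [cutLE_zero_iff, opNonneg_iff_expect]
  exact ⟨fun h ρ => h ⟨ρ, trivial⟩, fun h ρ => h ρ.1⟩

theorem cutLT_zero_aQ_iff (A : M.alg) :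
    CutLT 0 (aQ A ⊤) ↔ OpPos (A : Module.End ℂ D) := by
  have : PreconnectedSpace (⊤ : Opens (State M)) := Subtype.preconnectedSpace isPreconnected_univ
  rw [cutLT_zero_iff, opPos_iff_expect]
  exact exists_congr fun q => and_congr_right fun _ =>
    ⟨fun h ρ => h ⟨ρ, trivial⟩, fun h ρ => h ρ.1⟩

/-- Any nonzero vector of `D` normalizes to a pure state, so without states `D = 0`, and density
gives `H = 0`. -/
theorem subsingleton_of_isEmpty_state (hD : Dense (D : Set H)) [hM : IsEmpty (State M)] :
    Subsingleton H := by
  have hDbot : (D : Set H) ⊆ {0} := fun u hu => by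
    by_contra h0
    have hn : ‖u‖ ≠ 0 := norm_ne_zero_iff.2 h0
    refine hM.elim (pureState M ⟨((‖u‖⁻¹ : ℝ) : ℂ) • u, D.smul_mem _ hu⟩ ?_)
    rw [norm_smul, Complex.norm_real, norm_inv, norm_norm, inv_mul_cancel₀ hn]
  have h := closure_mono hDbot
  rw [hD.closure_eq, closure_singleton] at h
  exact ⟨fun x y => (h (Set.mem_univ x)).trans (h (Set.mem_univ y)).symm⟩

theorem isEssSelfAdjoint_of_subsingleton [Subsingleton H] (A : Module.End ℂ D) :
    IsEssSelfAdjoint A := by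
  have hs : ∀ S T : H →ₗ.[ℂ] H, S = T := fun S T =>
    LinearPMap.ext (Submodule.ext fun x => by
      rw [Subsingleton.elim x 0]; exact ⟨fun _ => zero_mem _, fun _ => zero_mem _⟩) fun _ _ _ => Subsingleton.elim _ _
  refine ⟨fun x => ?_, (hs _ _).le, hs _ _⟩
  rw [Subsingleton.elim x 0]
  exact subset_closure D.zero_mem

theorem exists_eq_aQ (hD : Dense (D : Set H)) {f : C((⊤ : Opens (State M)), ℝ)}
    (hf : f ∈ locallyLinear M ⊤) :
    ∃ A : M.alg, IsEssSelfAdjoint (A : Module.End ℂ D) ∧ f = aQ A ⊤ := by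
  rcases isEmpty_or_nonempty (State M) with hM | _
  · have := subsingleton_of_isEmpty_state (M := M) hD
    -- Without states there is no point at which to read off an operator, but then `H = 0` and the
    -- zero operator serves.
    exact ⟨0, isEssSelfAdjoint_of_subsingleton _, ContinuousMap.ext fun ρ => hM.elim ρ.1⟩
  · exact exists_eq_aQ_of_mem_locallyLinear hf

end Orders

end QRNumber
end

open QRNumber TopologicalSpace in
theorem lemma26 {H : Type*} [NormedAddCommGroup H] [InnerProductSpace ℂ H] [CompleteSpace H]
    [SeparableSpace H] (D : Submodule ℂ H) (hD : Dense (D : Set H)) (M : OStarAlgebra D) :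
    (∀ A : M.alg, IsEssSelfAdjoint (A : Module.End ℂ D) →
      (CutLE 0 (aQ A ⊤) ↔ OpNonneg (A : Module.End ℂ D)) ∧
      (CutLT 0 (aQ A ⊤) ↔ OpPos (A : Module.End ℂ D))) ∧
    (∀ f ∈ locallyLinear M ⊤,
      (CutLE 0 f ↔ SectionOpNonneg f) ∧
      (CutLT 0 f ↔ SectionOpPos f)) := by
  refine ⟨fun A _ => ⟨cutLE_zero_aQ_iff A, cutLT_zero_aQ_iff A⟩, fun f hf => ?_⟩
  obtain ⟨A, hA, rfl⟩ := exists_eq_aQ hD hf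
  constructor
  · refine ⟨fun h => ⟨A, hA, rfl, (cutLE_zero_aQ_iff A).1 h⟩, ?_⟩
    rintro ⟨B, -, hB, h⟩
    rw [hB]
    exact (cutLE_zero_aQ_iff B).2 h
  · refine ⟨fun h => ⟨A, hA, rfl, (cutLT_zero_aQ_iff A).1 h⟩, ?_⟩
    rintro ⟨B, -, hB, h⟩
    rw [hB]
    exact (cutLT_zero_aQ_iff B).2 h
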